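/- Let $(\mathbb X,\mathcal X)$ be a standard Borel space. On any measurable space $(E,\mathcal E)$, a sequence $(X_n)_{n\ge1}$ of $E$-valued random variables is an MVPS$(\theta,\nu,R)$ (measure-valued Pólya sequence), where $\theta>0$, $\nu$ is a probability measure on $E$ and $R=(R_x)_{x\in E}$ is a finite transition kernel on $E$, if $X_1\sim\nu$ and, for all $n\ge1$ and $A\in\mathcal E$, $$\mathbb P(X_{n+1}\in A\mid X_1,\dots,X_n)=\frac{\theta\nu(A)+\sum_{i=1}^nR_{X_i}(A)}{\theta+\sum_{i=1}^nR_{X_i}(E)}\quad\text{a.s.}$$ It is exchangeable if $(X_1,\dots,X_n)$ and $(X_{\sigma(1)},\dots,X_{\sigma(n)})$ have the same law for every $n$ and every permutation $\sigma$ of $\{1,\dots,n\}$. Let $(X_n)_{n\ge1}$ be an exchangeable MVPS$(\theta,\nu,R)$ on $\mathbb X$, put $Z:=\{x\in\mathbb X:R_x(\mathbb X)=0\}$, and suppose that $R_x(\mathbb X)=1$ for all $x\in Z^c$ (the canonical parametrization) and $0<\nu(Z)<1$. Then there exists a sub-$\sigma$-algebra $\mathcal G\subseteq\mathcal X$ such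 that (a) $\mathcal G$ is countably generated under $\nu$, i.e. there is $C\in\mathcal G$ with $\nu(C)=1$ for which $\mathcal G\cap C$ is countably generated; (b) $Z^c\in\mathcal G$, and for $\nu$-almost every $x\in Z^c$ $$\frac{R_x(\cdot)}{R_x(\mathbb X)}=\nu(Z^c)\,\nu(\cdot\mid\mathcal G)(x)+\nu(Z)\,\nu(\cdot\mid Z),$$ where $\nu(\cdot\mid\mathcal G)$ is a regular conditional distribution of $\nu$ given $\mathcal G$. Moreover, for every sub-$\sigma$-algebra $\mathcal G\subseteq\mathcal X$ satisfying (a) and (b) the following holds. Let $\pi(x)=[x]_{\mathcal G}:=\bigcap_{G\in\mathcal G,\,x\in G}G$ be the $\mathcal G$-atom of $x$, let $\Pi=\pi(\mathbb X)$ be the set of $\mathcal G$-atoms, equipped with the $\sigma$-algebra $\{P\subseteq\Pi:\pi^{-1}(P)\in\mathcal G\}$, and let $\nu_\pi=\nu\circ\pi^{-1}$. Then $(\pi(X_n))_{n\ge1}$ is an exchangeable MVPS$(\theta,\nu_\pi,R_\pi)$ on $\Pi$, where $$(R_\pi)_p(\cdot)=\begin{cases}\nu(Z^c)\,\delta_p(\cdot)+\nu(Z)\,\nu_\pi(\cdot\mid\pi(Z))&\text{if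 }p\in\pi(Z^c),\\0&\text{if }p\in\pi(Z).\end{cases}$$ -/

import Mathlib

open MeasureTheory ProbabilityTheory

/-- A sequence of random variables is exchangeable if the joint law of each initial segment is
invariant under permutations. Indices start at `0`: `X 0` is the first variable. -/
def Exchangeable {Ω E : Type*} {mΩ : MeasurableSpace Ω} [mE : MeasurableSpace E]
    (μ : Measure Ω) (X : ℕ → Ω → E) : Prop :=
  ∀ (n : ℕ) (σ : Equiv.Perm (Fin n)),
    IdentDistrib (fun ω (i : Fin n) => X i ω) (fun ω (i : Fin n) => X (σ i) ω) μ μ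

/-- The σ-algebra generated by the first `n` variables `X 0, …, X (n - 1)`. -/
abbrev pastSigma {Ω E : Type*} [mE : MeasurableSpace E] (X : ℕ → Ω → E) (n : ℕ) : MeasurableSpace Ω :=
  MeasurableSpace.comap (fun ω (i : Fin n) => X i ω) MeasurableSpace.pi

/-- `X` is a measure-valued Pólya sequence with parameters `θ`, `ν` and reinforcement kernel `R`.
The space `E` is an arbitrary measurable space. `Measurable R` and `finite_reinf` say that `R` is a
finite transition kernel; `predictive` says that the normalized urn content is a (regular) version
of the conditional distribution of `X n` given the first `n` variables. -/
structure IsMVPS {Ω E : Type*} {mΩ : MeasurableSpace Ω} {mE : MeasurableSpace E} (μ : Measure Ω)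
    (θ : ℝ) (ν : Measure E) (R : E → Measure E) (X : ℕ → Ω → E) : Prop where
  measurable_seq : ∀ n, Measurable (X n)
  theta_pos : 0 < θ
  isProbabilityMeasure : IsProbabilityMeasure ν
  measurable_reinf : Measurable R
  finite_reinf : ∀ x, IsFiniteMeasure (R x)
  law_first : μ.map (X 0) = ν
  predictive : ∀ n, 1 ≤ n → ∀ A : Set E, MeasurableSet A →
    μ⟦X n ⁻¹' A | pastSigma X n⟧ =ᵐ[μ] fun ω =>
      (θ * ν.real A + ∑ i : Fin n, (R (X i ω)).real A) /
        (θ + ∑ i : Fin n, (R (X i ω)).real Set.univ)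

/-- The set `Z` of points with zero reinforcement. -/
def nullPart {E : Type*} {mE : MeasurableSpace E} (R : E → Measure E) : Set E :=
  {x | R x Set.univ = 0}

/-- The parametrization is canonical: the reinforcement has total mass `1` at every point
outside the null part. -/
def IsCanonical {E : Type*} {mE : MeasurableSpace E} (R : E → Measure E) : Prop :=
  ∀ x ∈ (nullPart R)ᶜ, R x Set.univ = 1

/-- The sub-σ-algebra `G` is countably generated under `ν`: there is `C ∈ G` with `ν C = 1` whose
trace σ-algebra `G ∩ C` is countably generated. -/
def CountablyGeneratedUnder {E : Type*} (G : MeasurableSpace E) {mE : MeasurableSpace E}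
    (ν : Measure E) : Prop :=
  ∃ C : Set E, MeasurableSet[G] C ∧ ν C = 1 ∧
    @MeasurableSpace.CountablyGenerated C (MeasurableSpace.comap ((↑) : C → E) G)

/-- `G` is a conditioning σ-algebra of the reinforcement kernel `R` with null part `Z`: a
sub-σ-algebra, countably generated under `ν`, which contains `Zᶜ` and satisfies
`R_x / R_x(E) = ν(Zᶜ) ν(· ∣ G)(x) + ν(Z) ν(· ∣ Z)` for `ν`-almost every `x ∈ Zᶜ`.
Here `condExpKernel ν G` is the regular conditional distribution of `ν` given `G`. -/
structure IsConditioningSigma {E : Type*} (G : MeasurableSpace E) {mE : MeasurableSpace E}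
    [StandardBorelSpace E] (ν : Measure E) [IsFiniteMeasure ν] (R : E → Measure E) : Prop where
  le : G ≤ mE
  countablyGenerated : CountablyGeneratedUnder G ν
  measurableSet_compl : MeasurableSet[G] (nullPart R)ᶜ
  representation : ∀ᵐ x ∂ν, x ∈ (nullPart R)ᶜ →
    (R x Set.univ)⁻¹ • R x =
      ν (nullPart R)ᶜ • condExpKernel ν G x + ν (nullPart R) • ν[|nullPart R]

/-- The set `Π` of the atoms `[x]_G` of the σ-algebra `G`. -/
def AtomSpace {E : Type*} (G : MeasurableSpace E) : Type _ :=
  Set.range (fun x : E => @measurableAtom E G x)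

/-- The atom map `π`, which sends a point to its `G`-atom. -/
def atomMap {E : Type*} (G : MeasurableSpace E) : E → AtomSpace G :=
  fun x => ⟨@measurableAtom E G x, x, rfl⟩

/-- The σ-algebra on `Π` of all `P` with `π ⁻¹(P) ∈ G`. -/
instance AtomSpace.instMeasurableSpace {E : Type*} (G : MeasurableSpace E) :
    MeasurableSpace (AtomSpace G) :=
  MeasurableSpace.map (atomMap G) G

/-- The image measure `ν_π = ν ∘ π⁻¹` on the space of atoms. -/
noncomputable def atomLaw {E : Type*} (G : MeasurableSpace E) {mE : MeasurableSpace E}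
    (ν : Measure E) : Measure (AtomSpace G) :=
  ν.map (atomMap G)

open Classical in
/-- The reinforcement `R_π` on the space of atoms, for the base measure `ν` and the null part `Z`:
`ν(Zᶜ) δ_p + ν(Z) ν_π(· ∣ π(Z))` for `p ∈ π(Zᶜ)`, and `0` otherwise. -/
noncomputable def atomReinforcement {E : Type*} (G : MeasurableSpace E) {mE : MeasurableSpace E}
    (ν : Measure E) (Z : Set E) (p : AtomSpace G) :
    Measure (AtomSpace G) :=
  if p ∈ atomMap G '' Zᶜ then
    ν Zᶜ • Measure.dirac p + ν Z • (atomLaw G ν)[|atomMap G '' Z]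
  else 0

/-!
Exchanging the first two draws of the urn shows that, off the null part `Z`, the kernel `R` is
reversible with respect to `ν`, and that `R x` agrees with `ν` on `Z` for `ν`-almost all `x ∉ Z`.
So for `ρ = ν|_{Zᶜ}` and `κ x = (R x)|_{Zᶜ}`, only the `κ x` remain to be identified, and their
total mass is `ν Zᶜ`. Exchanging the second and third draws shows in addition that the measure
`ρ(dx) κ_x(dy) κ_x(dz)` is symmetric; by reversibility it equals `ρ(dx) κ_x(dy) κ_y(dz)`, hence
`κ y = κ x`, and then `R y = R x`, for `κ x`-almost all `y`. This means that `κ x` lives on the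
fibre of `R` through `x`, and together with reversibility it makes `κ x` the multiple `ν Zᶜ` of the
conditional law of `ν` given the σ-algebra generated by `R`.

Conversely, such a representation with respect to `G` says that the `G`-atom of a draw from `R x` is
with weight `ν Zᶜ` that of `x` and with weight `ν Z` a draw from `ν(· ∣ Z)`. The urn content is
therefore a function of the atoms of the past draws, so it is also the prediction given these atoms.
-/

section CountablyGenerated

theorem exists_countable_isPiSystem_generateFrom (E : Type*) [m : MeasurableSpace E]
    [MeasurableSpace.CountablyGenerated E] :
    ∃ S : Set (Set E), S.Countable ∧ IsPiSystem S ∧ Set.univ ∈ S ∧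
      m = MeasurableSpace.generateFrom S := by
  have hAlg := isSetAlgebra_generateSetAlgebra (𝒜 := MeasurableSpace.countableGeneratingSet E)
  refine ⟨generateSetAlgebra (MeasurableSpace.countableGeneratingSet E),
    countable_generateSetAlgebra MeasurableSpace.countable_countableGeneratingSet,
    fun s hs t ht _ => hAlg.inter_mem hs ht, hAlg.univ_mem, ?_⟩
  rw [generateFrom_generateSetAlgebra_eq, MeasurableSpace.generateFrom_countableGeneratingSet]

variable {E F : Type*} {mE : MeasurableSpace E} [MeasurableSpace.CountablyGenerated E]

theorem countablyGenerated_comap_measure (R : F → Measure E) [∀ x, IsFiniteMeasure (R x)] :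
    @MeasurableSpace.CountablyGenerated F
      (MeasurableSpace.comap R Measure.instMeasurableSpace) := by
  obtain ⟨S, hSc, hSpi, hSu, hSgen⟩ := exists_countable_isPiSystem_generateFrom E
  have : Countable S := hSc
  have comap_eq : MeasurableSpace.comap R Measure.instMeasurableSpace =
      MeasurableSpace.comap (fun x (s : S) => R x s) MeasurableSpace.pi := by
    refine le_antisymm (Measurable.comap_le ?_) (Measurable.comap_le ?_)
    · let := MeasurableSpace.comap (fun x (s : S) => R x s) MeasurableSpace.pi
      have hm (s : Set E) (hs : s ∈ S) : Measurable fun x => R x s :=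
        (measurable_pi_apply (⟨s, hs⟩ : S)).comp (comap_measurable fun x (s : S) => R x s)
      exact Measurable.measure_of_isPiSystem hSgen hSpi hm (hm _ hSu)
    · let := MeasurableSpace.comap R Measure.instMeasurableSpace
      exact measurable_pi_lambda _ fun s =>
        (Measure.measurable_coe (hSgen ▸ MeasurableSpace.measurableSet_generateFrom s.2)).comp
          (comap_measurable R)
  rw [comap_eq]
  exact MeasurableSpace.CountablyGenerated.comap _

theorem ae_measure_eq_of_forall_ae_apply_eq {mF : MeasurableSpace F} {ρ : Measure F}
    {κ η : F → Measure E} [∀ x, IsFiniteMeasure (κ x)]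
    (h : ∀ A, MeasurableSet A → ∀ᵐ x ∂ρ, κ x A = η x A) : ∀ᵐ x ∂ρ, κ x = η x := by
  obtain ⟨S, hSc, hSpi, hSu, hSgen⟩ := exists_countable_isPiSystem_generateFrom E
  have hS : ∀ᵐ x ∂ρ, ∀ A ∈ S, κ x A = η x A := (ae_ball_iff hSc).2 fun A hA =>
    h A (hSgen ▸ MeasurableSpace.measurableSet_generateFrom hA)
  filter_upwards [hS] with x hx
  exact ext_of_generate_finite S hSgen hSpi hx (hx _ hSu)

end CountablyGenerated

theorem measure_preimage_eq_indicator_of_ae_eq {E F : Type*} {mE : MeasurableSpace E}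
    {m : Measure E} {φ : E → F} {x : E} (h : ∀ᵐ y ∂m, φ y = φ x) (S : Set F) :
    m (φ ⁻¹' S) = (φ ⁻¹' S).indicator (fun _ => m Set.univ) x := by
  by_cases hx : φ x ∈ S
  · rw [Set.indicator_of_mem (Set.mem_preimage.2 hx)]
    refine measure_congr (Filter.eventuallyEq_univ.2 ?_)
    filter_upwards [h] with y hy
    rwa [Set.mem_preimage, hy]
  · rw [Set.indicator_of_notMem (Set.mem_preimage.not.2 hx)]
    refine measure_eq_zero_iff_ae_notMem.2 ?_
    filter_upwards [h] with y hy
    rwa [Set.mem_preimage, hy]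

section CondExpKernel

variable {E : Type*} {G mE : MeasurableSpace E} [StandardBorelSpace E] {ν : Measure E}
  [IsFiniteMeasure ν]

theorem setLIntegral_condExpKernel_apply (hG : G ≤ mE) {A B : Set E}
    (hA : MeasurableSet A) (hB : MeasurableSet[G] B) :
    ∫⁻ x in B, condExpKernel ν G x A ∂ν = ν (B ∩ A) := by
  have h := congrArg (fun m => m (B ×ˢ A)) (compProd_trim_condExpKernel (μ := ν) hG)
  have hdiag : @Measurable E (E × E) mE (G.prod mE) Function.diag :=
    (measurable_id.mono le_rfl hG).prodMk measurable_id
  rw [Measure.compProd_apply_prod hB hA, Measure.map_apply hdiag (hB.prod hA),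
    setLIntegral_trim hG (measurable_condExpKernel hA) hB] at h
  exact h

theorem condExpKernel_apply_ae_eq_indicator (hG : G ≤ mE) {s : Set E}
    (hs : MeasurableSet[G] s) :
    ∀ᵐ x ∂ν, condExpKernel ν G x s = s.indicator 1 x := by
  have hm : Measurable[G] (s.indicator (1 : E → ENNReal)) :=
    Measurable.indicator measurable_const hs
  refine ae_of_ae_trim hG (ae_eq_of_forall_setLIntegral_eq_of_sigmaFinite
    (measurable_condExpKernel (hG _ hs)) hm fun B hB _ => ?_)
  rw [setLIntegral_trim hG (measurable_condExpKernel (hG _ hs)) hB,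
    setLIntegral_trim hG hm hB,
    setLIntegral_condExpKernel_apply hG (hG _ hs) hB, lintegral_indicator_one (hG _ hs),
    Measure.restrict_apply (hG _ hs), Set.inter_comm]

theorem ae_restrict_eq_smul_condExpKernel (hG : G ≤ mE) {S : Set E} (hS : MeasurableSet[G] S)
    {κ : E → Measure E} [∀ x, IsFiniteMeasure (κ x)] {c : ENNReal}
    (hκ : ∀ A, MeasurableSet A → Measurable[G] fun x => κ x A)
    (h : ∀ A B, MeasurableSet A → MeasurableSet[G] B →
      ∫⁻ x in B, κ x A ∂(ν.restrict S) = c * ν.restrict S (B ∩ A)) :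
    ∀ᵐ x ∂(ν.restrict S), κ x = c • condExpKernel ν G x := by
  refine ae_measure_eq_of_forall_ae_apply_eq fun A hA => ae_of_ae_trim hG ?_
  have hm : Measurable[G] fun x => c * condExpKernel ν G x A :=
    (measurable_condExpKernel hA).const_mul _
  simp only [Measure.smul_apply, smul_eq_mul]
  refine ae_eq_of_forall_setLIntegral_eq_of_sigmaFinite (hκ A hA) hm fun B hB _ => ?_
  rw [setLIntegral_trim hG (hκ A hA) hB, setLIntegral_trim hG hm hB, h A B hA hB,
    lintegral_const_mul _ ((measurable_condExpKernel hA).mono hG le_rfl),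
    Measure.restrict_restrict (hG _ hB), setLIntegral_condExpKernel_apply hG hA (hB.inter hS),
    Measure.restrict_apply ((hG _ hB).inter hA), Set.inter_right_comm]

end CondExpKernel

section ReversibleKernel

variable {E : Type*} {mE : MeasurableSpace E} {ρ : Measure E} {κ : Kernel E E}

theorem bind_restrict_eq_withDensity_of_isReversible (hκ : κ.IsReversible ρ) {A : Set E}
    (hA : MeasurableSet A) : (ρ.restrict A).bind κ = ρ.withDensity fun x => κ x A := by
  ext B hB
  rw [Measure.bind_apply hB κ.aemeasurable, withDensity_apply _ hB, hκ hA hB]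

theorem ae_ae_of_isReversible (hκ : κ.IsReversible ρ) {P : E → Prop} (hP : ∀ᵐ y ∂ρ, P y) :
    ∀ᵐ x ∂ρ, ∀ᵐ y ∂(κ x), P y := by
  refine Measure.ae_ae_of_ae_bind κ.aemeasurable ?_
  have hbind := bind_restrict_eq_withDensity_of_isReversible hκ .univ
  rw [Measure.restrict_univ] at hbind
  rw [hbind]
  exact (withDensity_absolutelyContinuous ρ _).ae_le hP

theorem setLIntegral_setLIntegral_of_isReversible (hκ : κ.IsReversible ρ)
    {A B : Set E} (hA : MeasurableSet A) (hB : MeasurableSet B) {f : E → ENNReal}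
    (hf : Measurable f) :
    ∫⁻ x in A, ∫⁻ y in B, f y ∂(κ x) ∂ρ = ∫⁻ y in B, κ y A * f y ∂ρ := by
  simp only [← lintegral_indicator hB]
  rw [← Measure.lintegral_bind κ.aemeasurable (hf.indicator hB).aemeasurable,
    bind_restrict_eq_withDensity_of_isReversible hκ hA,
    lintegral_withDensity_eq_lintegral_mul _ (κ.measurable_coe hA) (hf.indicator hB)]
  exact lintegral_congr fun y => (Set.indicator_mul_right B (fun y => κ y A) f).symm

/-- Draw `Y₀` from `ρ` and then, conditionally on `Y₀`, two independent points `Y₁`, `Y₂` from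
`κ Y₀`. The law of `(Y₀, Y₁, Y₂)` is always symmetric in the last two coordinates; this notion
says that it is invariant under all permutations, which amounts to exchanging the first two. -/
def IsTripleExchangeable (κ : Kernel E E) (ρ : Measure E) : Prop :=
  ∀ ⦃A B C : Set E⦄, MeasurableSet A → MeasurableSet B → MeasurableSet C →
    ∫⁻ x in A, κ x B * κ x C ∂ρ = ∫⁻ x in B, κ x A * κ x C ∂ρ

theorem IsTripleExchangeable.ae_ae_eq [MeasurableSpace.CountablyGenerated E] [IsFiniteMeasure ρ]
    [IsFiniteKernel κ] (hex : IsTripleExchangeable κ ρ) (hκ : κ.IsReversible ρ) :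
    ∀ᵐ x ∂ρ, ∀ᵐ y ∂(κ x), κ y = κ x := by
  -- `ρ(dx) κ_x(dy) κ_y(dz) = ρ(dx) κ_x(dy) κ_x(dz)`: by reversibility the left-hand side is
  -- `ρ(dy) κ_y(dx) κ_y(dz)`.
  have compProd_eq : (ρ ⊗ₘ κ) ⊗ₘ κ.prodMkLeft E = (ρ ⊗ₘ κ) ⊗ₘ κ.prodMkRight E := by
    refine Measure.ext_prod₃_iff'.2 fun {A B C} hA hB hC => ?_
    rw [Measure.compProd_apply_prod (hA.prod hB) hC, Measure.compProd_apply_prod (hA.prod hB) hC,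
      Measure.setLIntegral_compProd (Kernel.measurable_coe _ hC) hA hB,
      Measure.setLIntegral_compProd (Kernel.measurable_coe _ hC) hA hB]
    simp only [Kernel.prodMkLeft_apply, Kernel.prodMkRight_apply, setLIntegral_const]
    rw [setLIntegral_setLIntegral_of_isReversible hκ hA hB (κ.measurable_coe hC),
      ← hex hA hB hC]
    simp only [mul_comm]
  exact Measure.ae_ae_of_ae_compProd (Kernel.ae_eq_of_compProd_eq compProd_eq)

end ReversibleKernel

section AtomSpace

variable {E : Type*} {G mE : MeasurableSpace E}

theorem measurable_atomMap (hG : G ≤ mE) : Measurable[mE] (atomMap G) :=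
  fun _ hP => hG _ hP

theorem atomMap_preimage_image {s : Set E} (hs : MeasurableSet[G] s) :
    atomMap G ⁻¹' (atomMap G '' s) = s := by
  refine subset_antisymm ?_ (Set.subset_preimage_image _ _)
  rintro x ⟨y, hy, hyx⟩
  have atom_eq : @measurableAtom E G y = @measurableAtom E G x := congrArg Subtype.val hyx
  have hx : x ∈ @measurableAtom E G y := atom_eq ▸ @mem_measurableAtom_self E G x
  exact @measurableAtom_subset E G s y hs hy x hx

theorem measurableSet_atomMap_image {s : Set E} (hs : MeasurableSet[G] s) :
    MeasurableSet (atomMap G '' s) := by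
  change MeasurableSet[G] (atomMap G ⁻¹' (atomMap G '' s))
  rwa [atomMap_preimage_image hs]

theorem atomLaw_apply (hG : G ≤ mE) (ν : Measure E) {P : Set (AtomSpace G)}
    (hP : MeasurableSet P) : atomLaw G ν P = ν (atomMap G ⁻¹' P) :=
  Measure.map_apply (measurable_atomMap hG) hP

theorem atomReinforcement_atomMap_apply (hG : G ≤ mE) (ν : Measure E) {Z : Set E}
    (hZ : MeasurableSet[G] Z) {P : Set (AtomSpace G)} (hP : MeasurableSet P) {x : E}
    (hx : x ∉ Z) :
    atomReinforcement G ν Z (atomMap G x) P =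
      ν Zᶜ * (atomMap G ⁻¹' P).indicator 1 x + ν Z * ν[atomMap G ⁻¹' P | Z] := by
  have cond_eq : (atomLaw G ν)[P | atomMap G '' Z] = ν[atomMap G ⁻¹' P | Z] := by
    have hπZ := measurableSet_atomMap_image hZ
    rw [cond_apply hπZ, cond_apply (hG _ hZ), atomLaw_apply hG ν hπZ,
      atomLaw_apply hG ν (hπZ.inter hP), Set.preimage_inter, atomMap_preimage_image hZ]
  rw [atomReinforcement, if_pos ⟨x, hx, rfl⟩, Measure.add_apply, Measure.smul_apply,
    Measure.smul_apply, smul_eq_mul, smul_eq_mul, Measure.dirac_apply' _ hP, cond_eq]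
  rfl

theorem atomReinforcement_atomMap_of_mem (ν : Measure E) {Z : Set E}
    (hZ : MeasurableSet[G] Z) {x : E} (hx : x ∈ Z) :
    atomReinforcement G ν Z (atomMap G x) = 0 := by
  refine if_neg fun h => ?_
  rw [← Set.mem_preimage, atomMap_preimage_image hZ.compl] at h
  exact h hx

theorem measurable_atomReinforcement (ν : Measure E) {Z : Set E} (hZ : MeasurableSet[G] Z) :
    Measurable (atomReinforcement G ν Z) := by
  classical
  refine Measurable.ite (measurableSet_atomMap_image hZ.compl) ?_ measurable_const
  refine Measure.measurable_of_measurable_coe _ fun P hP => ?_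
  simp only [Measure.add_apply, Measure.smul_apply, smul_eq_mul]
  exact (((Measure.measurable_coe hP).comp Measure.measurable_dirac).const_mul _).add_const _

theorem isFiniteMeasure_atomReinforcement (ν : Measure E) [IsFiniteMeasure ν] (Z : Set E)
    (p : AtomSpace G) : IsFiniteMeasure (atomReinforcement G ν Z p) := by
  have isFiniteMeasure_smul (s : Set E) (m : Measure (AtomSpace G)) [IsFiniteMeasure m] :
      IsFiniteMeasure (ν s • m) := m.smul_finite (measure_ne_top ν s)
  unfold atomReinforcement
  split_ifs <;> infer_instance

theorem IsConditioningSigma.reinf_preimage_ae_eq [StandardBorelSpace E] {ν : Measure E}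
    [IsFiniteMeasure ν] {R : E → Measure E} (h : IsConditioningSigma G ν R)
    (hcan : IsCanonical R) {P : Set (AtomSpace G)} (hP : MeasurableSet P) :
    ∀ᵐ x ∂ν, R x (atomMap G ⁻¹' P) = atomReinforcement G ν (nullPart R) (atomMap G x) P := by
  have hZ : MeasurableSet[G] (nullPart R) := by simpa using h.measurableSet_compl.compl
  filter_upwards [h.representation, condExpKernel_apply_ae_eq_indicator h.le hP]
    with x hRx hker
  by_cases hxZ : x ∈ nullPart R
  · rw [atomReinforcement_atomMap_of_mem ν hZ hxZ, Measure.measure_univ_eq_zero.1 hxZ]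
    rfl
  · have hR : R x = ν (nullPart R)ᶜ • condExpKernel ν G x + ν (nullPart R) • ν[|nullPart R] := by
      rw [← hRx hxZ, hcan x hxZ, inv_one, one_smul]
    rw [atomReinforcement_atomMap_apply h.le ν hZ hP hxZ, hR, Measure.add_apply,
      Measure.smul_apply, Measure.smul_apply, smul_eq_mul, smul_eq_mul]
    exact congrArg (ν (nullPart R)ᶜ * · + _) hker

end AtomSpace

theorem setLIntegral_ne_top_of_le_one {E : Type*} {mE : MeasurableSpace E} {ν : Measure E}
    [IsFiniteMeasure ν] {f : E → ENNReal} (hf : ∀ x, f x ≤ 1) (A : Set E) :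
    ∫⁻ x in A, f x ∂ν ≠ ⊤ :=
  (setLIntegral_lt_top_of_le_nnreal (measure_ne_top _ _) ⟨1, fun x _ => by simpa using hf x⟩).ne

theorem IsCanonical.apply_le_one {E : Type*} {mE : MeasurableSpace E} {R : E → Measure E}
    (hcan : IsCanonical R) (x : E) (A : Set E) : R x A ≤ 1 := by
  refine (measure_mono (Set.subset_univ A)).trans ?_
  by_cases hx : x ∈ nullPart R
  · exact (le_of_eq hx).trans zero_le_one
  · exact (hcan x hx).le

section ExchangeableSequence

variable {Ω E : Type*} {mΩ : MeasurableSpace Ω} {mE : MeasurableSpace E} {μ : Measure Ω}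
  {X : ℕ → Ω → E}

namespace Exchangeable

theorem comp {F : Type*} {mF : MeasurableSpace F} (hX : Exchangeable μ X) {f : E → F}
    (hf : Measurable f) : Exchangeable μ (fun n ω => f (X n ω)) := fun n σ =>
  (hX n σ).comp (u := fun x i => f (x i)) (by fun_prop)

theorem map_eq (hX : Exchangeable μ X) (n : ℕ) : μ.map (X n) = μ.map (X 0) := by
  have h := ((hX (n + 1) (Equiv.swap 0 (Fin.last n))).comp (measurable_pi_apply 0)).map_eq
  simp only [Function.comp_def, Equiv.swap_apply_left] at h
  exact h.symm

theorem setLIntegral_comm (hX : Exchangeable μ X) (hm : ∀ n, Measurable (X n))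
    {A B : Set E} (hA : MeasurableSet A) (hB : MeasurableSet B) {f : E → ENNReal}
    (hf : Measurable f) :
    ∫⁻ ω in X 0 ⁻¹' A ∩ X 1 ⁻¹' B, f (X 1 ω) ∂μ =
      ∫⁻ ω in X 0 ⁻¹' B ∩ X 1 ⁻¹' A, f (X 0 ω) ∂μ := by
  have hS : MeasurableSet {x : Fin 2 → E | x 0 ∈ A ∧ x 1 ∈ B} :=
    (measurable_pi_apply 0 hA).inter (measurable_pi_apply 1 hB)
  have h := congrArg (fun m => ∫⁻ x in {x | x 0 ∈ A ∧ x 1 ∈ B}, f (x 1) ∂m)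
    (hX 2 (Equiv.swap 0 1)).map_eq
  have hf₁ : Measurable fun x : Fin 2 → E => f (x 1) := hf.comp (measurable_pi_apply 1)
  simp only [setLIntegral_map hS hf₁ (measurable_pi_lambda _ fun _ => hm _)] at h
  rw [Set.inter_comm (X 0 ⁻¹' B)]
  exact h

theorem measure_inter_comm (hX : Exchangeable μ X) (hm : ∀ n, Measurable (X n)) {A B : Set E}
    (hA : MeasurableSet A) (hB : MeasurableSet B) :
    μ (X 0 ⁻¹' A ∩ X 1 ⁻¹' B) = μ (X 0 ⁻¹' B ∩ X 1 ⁻¹' A) := by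
  simpa only [setLIntegral_one] using hX.setLIntegral_comm hm hA hB (measurable_const (a := 1))

theorem measure_inter_inter_comm (hX : Exchangeable μ X) {A B C : Set E}
    (hA : MeasurableSet A) (hB : MeasurableSet B) (hC : MeasurableSet C) :
    μ (X 0 ⁻¹' A ∩ X 1 ⁻¹' B ∩ X 2 ⁻¹' C) = μ (X 0 ⁻¹' A ∩ X 1 ⁻¹' C ∩ X 2 ⁻¹' B) := by
  have hS : MeasurableSet {x : Fin 3 → E | (x 0 ∈ A ∧ x 1 ∈ B) ∧ x 2 ∈ C} :=
    ((measurable_pi_apply 0 hA).inter (measurable_pi_apply 1 hB)).inter (measurable_pi_apply 2 hC)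
  have h := (hX 3 (Equiv.swap 1 2)).measure_mem_eq hS
  have swap_zero : (Equiv.swap (1 : Fin 3) 2) 0 = 0 := by decide
  simp only [Set.preimage_ofPred_eq, Equiv.swap_apply_left, Equiv.swap_apply_right,
    swap_zero] at h
  rw [Set.inter_right_comm (X 0 ⁻¹' A) (X 1 ⁻¹' C)]
  exact h

end Exchangeable

theorem pastSigma_comp_le {F : Type*} {mF : MeasurableSpace F} {f : E → F} (hf : Measurable f)
    (X : ℕ → Ω → E) (n : ℕ) : pastSigma (fun k ω => f (X k ω)) n ≤ pastSigma X n := by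
  rintro _ ⟨t, ht, rfl⟩
  have hf' : Measurable fun (x : Fin n → E) i => f (x i) := by fun_prop
  exact ⟨_, hf' ht, rfl⟩

theorem condExp_ae_eq_of_le {V : Type*} [NormedAddCommGroup V] [NormedSpace ℝ V]
    [CompleteSpace V] {m₁ m₂ : MeasurableSpace Ω} [IsFiniteMeasure μ] (h₁₂ : m₁ ≤ m₂)
    (h₂ : m₂ ≤ mΩ) {f g : Ω → V} (hg : StronglyMeasurable[m₁] g) (hfg : μ[f | m₂] =ᵐ[μ] g) :
    μ[f | m₁] =ᵐ[μ] g := by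
  refine (condExp_condExp_of_le h₁₂ h₂).symm.trans ((condExp_congr_ae hfg).trans ?_)
  rw [condExp_of_stronglyMeasurable (h₁₂.trans h₂) hg (integrable_condExp.congr hfg)]

end ExchangeableSequence

/-- The conditional probability that the next draw of an urn with parameters `θ`, `ν` and `R`
falls in `A` when the previous draws are `x`, as an extended nonnegative real. -/
noncomputable def predictiveProb {E : Type*} [MeasurableSpace E] (θ : ℝ) (ν : Measure E)
    (R : E → Measure E) (A : Set E) {n : ℕ} (x : Fin n → E) : ENNReal :=
  (ENNReal.ofReal θ * ν A + ∑ i, R (x i) A) / (ENNReal.ofReal θ + ∑ i, R (x i) Set.univ)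

namespace IsMVPS

variable {Ω E : Type*} {mΩ : MeasurableSpace Ω} {mE : MeasurableSpace E} {μ : Measure Ω}
  {θ : ℝ} {ν : Measure E} {R : E → Measure E} {X : ℕ → Ω → E}

theorem isProbabilityMeasure_of_law_first (hX : IsMVPS μ θ ν R X) : IsProbabilityMeasure μ := by
  have := hX.isProbabilityMeasure
  rw [← hX.law_first] at this
  exact Measure.isProbabilityMeasure_of_map (X 0)

theorem measurable_past (hX : IsMVPS μ θ ν R X) (n : ℕ) :
    Measurable fun ω (i : Fin n) => X i ω :=
  measurable_pi_lambda _ fun i => hX.measurable_seq i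

theorem measurable_reinf_apply (hX : IsMVPS μ θ ν R X) {A : Set E} (hA : MeasurableSet A) :
    Measurable fun x => R x A :=
  (Measure.measurable_coe hA).comp hX.measurable_reinf

theorem measurableSet_nullPart (hX : IsMVPS μ θ ν R X) : MeasurableSet (nullPart R) :=
  hX.measurable_reinf_apply .univ (measurableSet_singleton 0)

section Map

variable {F : Type*} {mF : MeasurableSpace F} {f : E → F} {S : F → Measure F}

theorem predictive_map_ae_eq (hX : IsMVPS μ θ ν R X) (hlaw : ∀ n, μ.map (X n) = ν)
    (hf : Measurable f)
    (hRS : ∀ P : Set F, MeasurableSet P → ∀ᵐ x ∂ν, R x (f ⁻¹' P) = S (f x) P)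
    {n : ℕ} (hn : 1 ≤ n) {P : Set F} (hP : MeasurableSet P) :
    μ⟦(fun ω => f (X n ω)) ⁻¹' P | pastSigma X n⟧ =ᵐ[μ] fun ω =>
      (θ * (ν.map f).real P + ∑ i : Fin n, (S (f (X i ω))).real P) /
        (θ + ∑ i : Fin n, (S (f (X i ω))).real Set.univ) := by
  have reinf_eq (Q : Set F) (hQ : MeasurableSet Q) :
      ∀ᵐ ω ∂μ, ∀ i : Fin n, R (X i ω) (f ⁻¹' Q) = S (f (X i ω)) Q := by
    refine ae_all_iff.2 fun i => ae_of_ae_map (p := fun x => R x (f ⁻¹' Q) = S (f x) Q)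
      (hX.measurable_seq i).aemeasurable ?_
    rw [hlaw]
    exact hRS Q hQ
  filter_upwards [hX.predictive n hn _ (hf hP), reinf_eq P hP, reinf_eq Set.univ .univ]
    with ω hω hRP hRuniv
  simp only [Set.preimage_univ] at hRuniv
  refine hω.trans ?_
  simp only [Measure.real, hRP, hRuniv, Measure.map_apply hf hP]

protected theorem map (hX : IsMVPS μ θ ν R X) (hlaw : ∀ n, μ.map (X n) = ν) (hf : Measurable f)
    (hS : Measurable S) (hSfin : ∀ y, IsFiniteMeasure (S y))
    (hRS : ∀ P : Set F, MeasurableSet P → ∀ᵐ x ∂ν, R x (f ⁻¹' P) = S (f x) P) :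
    IsMVPS μ θ (ν.map f) S (fun n ω => f (X n ω)) where
  measurable_seq n := hf.comp (hX.measurable_seq n)
  theta_pos := hX.theta_pos
  isProbabilityMeasure :=
    have := hX.isProbabilityMeasure
    Measure.isProbabilityMeasure_map hf.aemeasurable
  measurable_reinf := hS
  finite_reinf := hSfin
  law_first := by
    rw [← hX.law_first, Measure.map_map hf (hX.measurable_seq 0)]
    rfl
  predictive n hn P hP := by
    have := hX.isProbabilityMeasure_of_law_first
    have measurable_sum (Q : Set F) (hQ : MeasurableSet Q) :
        Measurable fun y : Fin n → F => ∑ i : Fin n, (S (y i)).real Q :=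
      Finset.measurable_sum _ fun i _ =>
        (((Measure.measurable_coe hQ).comp hS).comp (measurable_pi_apply i)).ennreal_toReal
    have measurable_ratio : Measurable fun y : Fin n → F =>
        (θ * (ν.map f).real P + ∑ i : Fin n, (S (y i)).real P) /
          (θ + ∑ i : Fin n, (S (y i)).real Set.univ) :=
      ((measurable_sum P hP).const_add _).div ((measurable_sum _ .univ).const_add _)
    exact condExp_ae_eq_of_le (pastSigma_comp_le hf X n) (hX.measurable_past n).comap_le
      (measurable_ratio.comp (comap_measurable _)).stronglyMeasurable
      (hX.predictive_map_ae_eq hlaw hf hRS hn hP)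

end Map

theorem measurable_sum_reinf (hX : IsMVPS μ θ ν R X) (n : ℕ) {A : Set E}
    (hA : MeasurableSet A) : Measurable fun x : Fin n → E => ∑ i, R (x i) A :=
  Finset.measurable_sum _ fun i _ => (hX.measurable_reinf_apply hA).comp (measurable_pi_apply i)

theorem measurable_predictiveProb (hX : IsMVPS μ θ ν R X) (n : ℕ) {A : Set E}
    (hA : MeasurableSet A) : Measurable (predictiveProb θ ν R A (n := n)) :=
  ((hX.measurable_sum_reinf n hA).const_add _).div ((hX.measurable_sum_reinf n .univ).const_add _)

theorem ofReal_predictive (hX : IsMVPS μ θ ν R X) (A : Set E) {n : ℕ} (x : Fin n → E) :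
    ENNReal.ofReal ((θ * ν.real A + ∑ i, (R (x i)).real A) /
      (θ + ∑ i, (R (x i)).real Set.univ)) = predictiveProb θ ν R A x := by
  have := hX.isProbabilityMeasure
  have := hX.finite_reinf
  have hθ := hX.theta_pos
  have hR (i : Fin n) (B : Set E) : ENNReal.ofReal ((R (x i)).real B) = R (x i) B :=
    ofReal_measureReal
  rw [predictiveProb, ENNReal.ofReal_div_of_pos (by positivity),
    ENNReal.ofReal_add (by positivity) (by positivity),
    ENNReal.ofReal_add (by positivity) (by positivity), ENNReal.ofReal_mul hθ.le,
    ENNReal.ofReal_sum_of_nonneg (fun _ _ => measureReal_nonneg),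
    ENNReal.ofReal_sum_of_nonneg (fun _ _ => measureReal_nonneg), ofReal_measureReal]
  simp only [hR]

theorem measure_past_inter (hX : IsMVPS μ θ ν R X) {n : ℕ} (hn : 1 ≤ n)
    {S : Set (Fin n → E)} (hS : MeasurableSet S) {A : Set E} (hA : MeasurableSet A) :
    μ ((fun ω (i : Fin n) => X i ω) ⁻¹' S ∩ X n ⁻¹' A) =
      ∫⁻ ω in (fun ω (i : Fin n) => X i ω) ⁻¹' S,
        predictiveProb θ ν R A (fun i : Fin n => X i ω) ∂μ := by
  have := hX.isProbabilityMeasure_of_law_first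
  have hθ := hX.theta_pos
  have hpast := hX.measurable_past n
  have hXA : MeasurableSet (X n ⁻¹' A) := hX.measurable_seq n hA
  have hpred := hX.predictive n hn A hA
  have h := setIntegral_condExp hpast.comap_le
    ((integrable_const (1 : ℝ)).indicator hXA : Integrable _ μ) ⟨S, hS, rfl⟩
  rw [setIntegral_congr_ae (hpast hS) (hpred.mono fun ω hω _ => hω),
    setIntegral_indicator hXA, setIntegral_const, smul_eq_mul, mul_one] at h
  rw [← ofReal_measureReal, ← h, ofReal_integral_eq_lintegral_ofReal
    (integrable_condExp.congr hpred).integrableOn (ae_of_all _ fun ω => by positivity)]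
  exact lintegral_congr fun ω => hX.ofReal_predictive A _

theorem map_past_restrict (hX : IsMVPS μ θ ν R X) {n : ℕ} (hn : 1 ≤ n) {A : Set E}
    (hA : MeasurableSet A) :
    (μ.restrict (X n ⁻¹' A)).map (fun ω (i : Fin n) => X i ω) =
      (μ.map fun ω (i : Fin n) => X i ω).withDensity (predictiveProb θ ν R A) := by
  have hpast := hX.measurable_past n
  ext S hS
  rw [Measure.map_apply hpast hS, Measure.restrict_apply (hpast hS), withDensity_apply _ hS,
    setLIntegral_map hS (hX.measurable_predictiveProb n hA) hpast, hX.measure_past_inter hn hS hA]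

theorem mul_setLIntegral_past_inter (hX : IsMVPS μ θ ν R X) {n : ℕ} (hn : 1 ≤ n)
    {S : Set (Fin n → E)} (hS : MeasurableSet S) {c : ENNReal} (hc : c ≠ ⊤)
    (hSc : ∀ x ∈ S, ∑ i, R (x i) Set.univ = c) {A : Set E} (hA : MeasurableSet A)
    {g : (Fin n → E) → ENNReal} (hg : Measurable g) :
    (ENNReal.ofReal θ + c) *
        ∫⁻ ω in (fun ω (i : Fin n) => X i ω) ⁻¹' S ∩ X n ⁻¹' A, g (fun i => X i ω) ∂μ =
      ∫⁻ ω in (fun ω (i : Fin n) => X i ω) ⁻¹' S,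
        (ENNReal.ofReal θ * ν A + ∑ i : Fin n, R (X i ω) A) * g (fun i => X i ω) ∂μ := by
  have hpast := hX.measurable_past n
  have hnum := (hX.measurable_sum_reinf n hA).const_add (ENNReal.ofReal θ * ν A)
  have hprob := hX.measurable_predictiveProb n hA
  have ht : ENNReal.ofReal θ + c ≠ 0 := by simp [hX.theta_pos]
  rw [← Measure.restrict_restrict (hpast hS), ← setLIntegral_map hS hg hpast,
    hX.map_past_restrict hn hA, restrict_withDensity hS,
    lintegral_withDensity_eq_lintegral_mul _ hprob hg,
    ← lintegral_const_mul _ (hprob.mul hg)]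
  refine Eq.trans ?_ (setLIntegral_map hS (hnum.mul hg) hpast)
  refine setLIntegral_congr_fun hS fun x hx => ?_
  simp only [Pi.mul_apply, predictiveProb, hSc x hx]
  rw [← mul_assoc, ENNReal.mul_div_cancel ht (by finiteness)]

theorem mul_setLIntegral_first (hX : IsMVPS μ θ ν R X) {A B : Set E} (hA : MeasurableSet A)
    (hB : MeasurableSet B) {c : ENNReal} (hc : c ≠ ⊤) (hAc : ∀ x ∈ A, R x Set.univ = c)
    {f : E → ENNReal} (hf : Measurable f) :
    (ENNReal.ofReal θ + c) * ∫⁻ ω in X 0 ⁻¹' A ∩ X 1 ⁻¹' B, f (X 0 ω) ∂μ =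
      ENNReal.ofReal θ * ν B * ∫⁻ x in A, f x ∂ν + ∫⁻ x in A, R x B * f x ∂ν := by
  have hS : MeasurableSet {x : Fin 1 → E | x 0 ∈ A} := measurable_pi_apply 0 hA
  have h := hX.mul_setLIntegral_past_inter le_rfl hS hc
    (fun x (hx : x 0 ∈ A) => by simpa using hAc _ hx) hB (hf.comp (measurable_pi_apply 0))
  simp only [Fintype.sum_unique] at h
  have hm := (hX.measurable_reinf_apply hB).const_add (ENNReal.ofReal θ * ν B)
  have hlaw := setLIntegral_map (μ := μ) hA (hm.mul hf) (hX.measurable_seq 0)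
  refine h.trans (hlaw.symm.trans ?_)
  rw [hX.law_first, ← lintegral_const_mul _ hf, ← lintegral_add_left (hf.const_mul _)]
  simp only [Pi.mul_apply, add_mul]

theorem mul_measure_triple (hX : IsMVPS μ θ ν R X) {A B C : Set E} (hA : MeasurableSet A)
    (hB : MeasurableSet B) (hC : MeasurableSet C) (hAR : ∀ x ∈ A, R x Set.univ = 1)
    (hBR : ∀ x ∈ B, R x Set.univ = 1) :
    (ENNReal.ofReal θ + 2) * μ (X 0 ⁻¹' A ∩ X 1 ⁻¹' B ∩ X 2 ⁻¹' C) =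
      ENNReal.ofReal θ * ν C * μ (X 0 ⁻¹' A ∩ X 1 ⁻¹' B) +
        (∫⁻ ω in X 0 ⁻¹' A ∩ X 1 ⁻¹' B, R (X 0 ω) C ∂μ +
          ∫⁻ ω in X 0 ⁻¹' A ∩ X 1 ⁻¹' B, R (X 1 ω) C ∂μ) := by
  have hS : MeasurableSet {x : Fin 2 → E | x 0 ∈ A ∧ x 1 ∈ B} :=
    (measurable_pi_apply 0 hA).inter (measurable_pi_apply 1 hB)
  have hmass (x : Fin 2 → E) (hx : x 0 ∈ A ∧ x 1 ∈ B) : ∑ i, R (x i) Set.univ = 2 := by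
    rw [Fin.sum_univ_two, hAR _ hx.1, hBR _ hx.2, one_add_one_eq_two]
  have h := hX.mul_setLIntegral_past_inter one_le_two hS (by finiteness) hmass hC
    (measurable_const (a := 1))
  have hm (i : ℕ) : Measurable fun ω => R (X i ω) C :=
    (hX.measurable_reinf_apply hC).comp (hX.measurable_seq i)
  simp only [setLIntegral_one, mul_one, Fin.sum_univ_two] at h
  refine h.trans ?_
  rw [lintegral_add_left measurable_const, setLIntegral_const]
  exact congrArg (_ + ·) (lintegral_add_left (hm 0) _)

theorem mul_measure_first (hX : IsMVPS μ θ ν R X) {A B : Set E} (hA : MeasurableSet A)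
    (hB : MeasurableSet B) {c : ENNReal} (hc : c ≠ ⊤) (hAc : ∀ x ∈ A, R x Set.univ = c) :
    (ENNReal.ofReal θ + c) * μ (X 0 ⁻¹' A ∩ X 1 ⁻¹' B) =
      ENNReal.ofReal θ * ν B * ν A + ∫⁻ x in A, R x B ∂ν := by
  simpa only [setLIntegral_one, mul_one] using
    hX.mul_setLIntegral_first hA hB hc hAc (measurable_const (a := 1))

/-- The reinforcement kernel, restricted to draws outside the null part. -/
noncomputable def nonnullKernel (hX : IsMVPS μ θ ν R X) : Kernel E E :=
  Kernel.restrict ⟨R, hX.measurable_reinf⟩ hX.measurableSet_nullPart.compl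

theorem nonnullKernel_apply (hX : IsMVPS μ θ ν R X) (x : E) :
    hX.nonnullKernel x = (R x).restrict (nullPart R)ᶜ := rfl

theorem nonnullKernel_apply_apply (hX : IsMVPS μ θ ν R X) (x : E) {A : Set E}
    (hA : MeasurableSet A) : hX.nonnullKernel x A = R x (A ∩ (nullPart R)ᶜ) :=
  Measure.restrict_apply hA

theorem isFiniteKernel_nonnullKernel (hX : IsMVPS μ θ ν R X) (hcan : IsCanonical R) :
    IsFiniteKernel hX.nonnullKernel :=
  ⟨1, ENNReal.one_lt_top, fun x => by
    rw [hX.nonnullKernel_apply_apply x .univ]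
    exact hcan.apply_le_one x _⟩

section Exchangeable

variable (hX : IsMVPS μ θ ν R X) (hcan : IsCanonical R) (hexch : Exchangeable μ X)
  {A B C : Set E} (hA : MeasurableSet A) (hB : MeasurableSet B) (hC : MeasurableSet C)
include hX hcan hexch hA hB

theorem setLIntegral_reinf_comm (hAZ : A ⊆ (nullPart R)ᶜ) (hBZ : B ⊆ (nullPart R)ᶜ) :
    ∫⁻ x in A, R x B ∂ν = ∫⁻ x in B, R x A ∂ν := by
  have := hX.isProbabilityMeasure
  have hAB := hX.mul_measure_first hA hB ENNReal.one_ne_top fun x hx => hcan x (hAZ hx)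
  rw [hexch.measure_inter_comm hX.measurable_seq hA hB,
    hX.mul_measure_first hB hA ENNReal.one_ne_top fun x hx => hcan x (hBZ hx),
    mul_right_comm] at hAB
  exact ((ENNReal.add_right_inj (by finiteness)).1 hAB).symm

theorem setLIntegral_reinf_of_subset_nullPart (hAZ : A ⊆ (nullPart R)ᶜ) (hBZ : B ⊆ nullPart R) :
    ∫⁻ x in A, R x B ∂ν = ν B * ν A := by
  have := hX.isProbabilityMeasure
  have hBA := hX.mul_measure_first hB hA ENNReal.zero_ne_top fun x hx => hBZ hx
  have reinf_null : ∫⁻ x in B, R x A ∂ν = 0 := by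
    rw [setLIntegral_congr_fun hB fun x hx =>
      measure_mono_null (Set.subset_univ A) (hBZ hx), lintegral_zero]
  have independent : μ (X 0 ⁻¹' A ∩ X 1 ⁻¹' B) = ν B * ν A := by
    rw [add_zero, reinf_null, add_zero, mul_assoc] at hBA
    rw [hexch.measure_inter_comm hX.measurable_seq hA hB, mul_comm (ν B)]
    exact (ENNReal.mul_right_inj (by simpa using hX.theta_pos) ENNReal.ofReal_ne_top).1 hBA
  have hAB := hX.mul_measure_first hA hB ENNReal.one_ne_top fun x hx => hcan x (hAZ hx)
  rw [independent, add_mul, one_mul, ← mul_assoc] at hAB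
  exact ((ENNReal.add_right_inj (by finiteness)).1 hAB).symm

include hC

theorem mul_mul_measure_triple (hAZ : A ⊆ (nullPart R)ᶜ) (hBZ : B ⊆ (nullPart R)ᶜ) :
    (ENNReal.ofReal θ + 1) *
        ((ENNReal.ofReal θ + 2) * μ (X 0 ⁻¹' A ∩ X 1 ⁻¹' B ∩ X 2 ⁻¹' C)) =
      ENNReal.ofReal θ * ν C * (ENNReal.ofReal θ * ν B * ν A + ∫⁻ x in A, R x B ∂ν) +
        ((ENNReal.ofReal θ * ν B * ∫⁻ x in A, R x C ∂ν + ∫⁻ x in A, R x B * R x C ∂ν) +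
          (ENNReal.ofReal θ * ν A * ∫⁻ x in B, R x C ∂ν + ∫⁻ x in B, R x A * R x C ∂ν)) := by
  have hAR (x) (hx : x ∈ A) : R x Set.univ = 1 := hcan x (hAZ hx)
  have hBR (x) (hx : x ∈ B) : R x Set.univ = 1 := hcan x (hBZ hx)
  have hRC := hX.measurable_reinf_apply hC
  rw [hX.mul_measure_triple hA hB hC hAR hBR, hexch.setLIntegral_comm hX.measurable_seq hA hB hRC,
    mul_add, mul_add, mul_left_comm, hX.mul_measure_first hA hB ENNReal.one_ne_top hAR,
    hX.mul_setLIntegral_first hA hB ENNReal.one_ne_top hAR hRC,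
    hX.mul_setLIntegral_first hB hA ENNReal.one_ne_top hBR hRC]

theorem setLIntegral_reinf_mul_reinf_comm (hAZ : A ⊆ (nullPart R)ᶜ) (hBZ : B ⊆ (nullPart R)ᶜ)
    (hCZ : C ⊆ (nullPart R)ᶜ) :
    ∫⁻ x in B, R x A * R x C ∂ν = ∫⁻ x in C, R x A * R x B ∂ν := by
  have := hX.isProbabilityMeasure
  have hAB := hX.mul_mul_measure_triple hcan hexch hA hB hC hAZ hBZ
  rw [hexch.measure_inter_inter_comm hA hB hC,
    hX.mul_mul_measure_triple hcan hexch hA hC hB hAZ hCZ,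
    hX.setLIntegral_reinf_comm hcan hexch hC hB hCZ hBZ] at hAB
  have hr (S D : Set E) : ∫⁻ x in S, R x D ∂ν ≠ ⊤ :=
    setLIntegral_ne_top_of_le_one (hcan.apply_le_one · D) S
  have hs : ∫⁻ x in A, R x B * R x C ∂ν ≠ ⊤ :=
    setLIntegral_ne_top_of_le_one
      (fun x => mul_le_one' (hcan.apply_le_one x B) (hcan.apply_le_one x C)) A
  have hrB := hr A B
  have hrC := hr A C
  have hrBC := hr B C
  simp only [mul_comm (R _ C) (R _ B)] at hAB
  -- `hAB` equates the expansions of `μ(X₀ ∈ A, X₁ ∈ B, X₂ ∈ C)` and `μ(X₀ ∈ A, X₁ ∈ C, X₂ ∈ B)`;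
  -- `common` collects the terms which occur in both.
  set common := ENNReal.ofReal θ * ν B * (ENNReal.ofReal θ * ν C * ν A + ∫⁻ x in A, R x C ∂ν) +
    (ENNReal.ofReal θ * ν C * ∫⁻ x in A, R x B ∂ν + ∫⁻ x in A, R x B * R x C ∂ν) +
      ENNReal.ofReal θ * ν A * ∫⁻ x in B, R x C ∂ν with common_eq
  have common_ne_top : common ≠ ⊤ := by finiteness
  refine ((ENNReal.add_right_inj common_ne_top).1 ?_).symm
  rw [common_eq, add_assoc, add_assoc, hAB]
  ring

end Exchangeable

section NonnullKernel

variable (hX : IsMVPS μ θ ν R X) (hcan : IsCanonical R) (hexch : Exchangeable μ X)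
include hX hcan hexch

theorem isReversible_nonnullKernel :
    hX.nonnullKernel.IsReversible (ν.restrict (nullPart R)ᶜ) := by
  intro A B hA hB
  have hZ := hX.measurableSet_nullPart.compl
  simp only [hX.nonnullKernel_apply_apply _ hA, hX.nonnullKernel_apply_apply _ hB,
    Measure.restrict_restrict hA, Measure.restrict_restrict hB]
  exact hX.setLIntegral_reinf_comm hcan hexch (hA.inter hZ) (hB.inter hZ)
    Set.inter_subset_right Set.inter_subset_right

theorem isTripleExchangeable_nonnullKernel :
    IsTripleExchangeable hX.nonnullKernel (ν.restrict (nullPart R)ᶜ) := by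
  intro A B C hA hB hC
  have hZ := hX.measurableSet_nullPart.compl
  simp only [hX.nonnullKernel_apply_apply _ hA, hX.nonnullKernel_apply_apply _ hB,
    hX.nonnullKernel_apply_apply _ hC, Measure.restrict_restrict hA, Measure.restrict_restrict hB]
  have h := hX.setLIntegral_reinf_mul_reinf_comm hcan hexch (hC.inter hZ) (hA.inter hZ)
    (hB.inter hZ) Set.inter_subset_right Set.inter_subset_right Set.inter_subset_right
  simpa only [mul_comm (R _ (C ∩ _))] using h

theorem restrict_nullPart_ae_eq [MeasurableSpace.CountablyGenerated E] :
    ∀ᵐ x ∂ν.restrict (nullPart R)ᶜ, (R x).restrict (nullPart R) = ν.restrict (nullPart R) := by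
  have := hX.isProbabilityMeasure
  have := hX.finite_reinf
  have hZ := hX.measurableSet_nullPart
  refine ae_measure_eq_of_forall_ae_apply_eq fun A hA => ?_
  simp only [Measure.restrict_apply hA]
  refine ae_eq_of_forall_setLIntegral_eq_of_sigmaFinite
    (hX.measurable_reinf_apply (hA.inter hZ)) measurable_const fun B hB _ => ?_
  rw [Measure.restrict_restrict hB, setLIntegral_const]
  exact hX.setLIntegral_reinf_of_subset_nullPart hcan hexch (hB.inter hZ.compl) (hA.inter hZ)
    Set.inter_subset_right Set.inter_subset_right

theorem nonnullKernel_univ_ae_eq [MeasurableSpace.CountablyGenerated E] :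
    ∀ᵐ x ∂ν.restrict (nullPart R)ᶜ, hX.nonnullKernel x Set.univ = ν (nullPart R)ᶜ := by
  have := hX.isProbabilityMeasure
  have hZ := hX.measurableSet_nullPart
  filter_upwards [hX.restrict_nullPart_ae_eq hcan hexch, ae_restrict_mem hZ.compl] with x hx hxZ
  have : IsProbabilityMeasure (R x) := ⟨hcan x hxZ⟩
  have null_eq := congrArg (· Set.univ) hx
  simp only [Measure.restrict_apply_univ] at null_eq
  rw [nonnullKernel_apply, Measure.restrict_apply_univ, prob_compl_eq_one_sub hZ,
    prob_compl_eq_one_sub hZ, null_eq]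

theorem reinf_ae_ae_eq [MeasurableSpace.CountablyGenerated E] :
    ∀ᵐ x ∂ν.restrict (nullPart R)ᶜ, ∀ᵐ y ∂(hX.nonnullKernel x), R y = R x := by
  have := hX.isProbabilityMeasure
  have := hX.isFiniteKernel_nonnullKernel hcan
  have hZ := hX.measurableSet_nullPart
  have hrev := hX.isReversible_nonnullKernel hcan hexch
  have null_eq := hX.restrict_nullPart_ae_eq hcan hexch
  filter_upwards [(hX.isTripleExchangeable_nonnullKernel hcan hexch).ae_ae_eq hrev,
    ae_ae_of_isReversible hrev null_eq, null_eq] with x hκ hnull hxnull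
  filter_upwards [hκ, hnull] with y hyκ hynull
  rw [← Measure.restrict_add_restrict_compl (μ := R y) hZ,
    ← Measure.restrict_add_restrict_compl (μ := R x) hZ, hynull, hxnull,
    ← hX.nonnullKernel_apply y, hyκ, hX.nonnullKernel_apply x]

theorem nonnullKernel_preimage_ae_eq [MeasurableSpace.CountablyGenerated E]
    (S : Set (Measure E)) :
    ∀ᵐ x ∂ν.restrict (nullPart R)ᶜ,
      hX.nonnullKernel x (R ⁻¹' S) = (R ⁻¹' S).indicator (fun _ => ν (nullPart R)ᶜ) x := by
  filter_upwards [hX.reinf_ae_ae_eq hcan hexch, hX.nonnullKernel_univ_ae_eq hcan hexch]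
    with x hx hxuniv
  rw [measure_preimage_eq_indicator_of_ae_eq hx, hxuniv]

end NonnullKernel

end IsMVPS

/-- The σ-algebra generated by a family of measures, that is, by the maps `x ↦ R x A`. For the
reinforcement kernel of an exchangeable urn it is a conditioning σ-algebra. -/
abbrev reinfSigma {E : Type*} [MeasurableSpace E] (R : E → Measure E) : MeasurableSpace E :=
  MeasurableSpace.comap R Measure.instMeasurableSpace

theorem measurable_reinfSigma_apply {E : Type*} [MeasurableSpace E] (R : E → Measure E)
    {A : Set E} (hA : MeasurableSet A) : Measurable[reinfSigma R] fun x => R x A :=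
  (Measure.measurable_coe hA).comp (comap_measurable R)

theorem measurableSet_reinfSigma_compl_nullPart {E : Type*} [MeasurableSpace E]
    (R : E → Measure E) : MeasurableSet[reinfSigma R] (nullPart R)ᶜ :=
  (measurable_reinfSigma_apply R .univ (measurableSet_singleton 0)).compl

theorem smul_cond_eq_restrict {E : Type*} {mE : MeasurableSpace E} (ν : Measure E)
    [IsFiniteMeasure ν] (s : Set E) : ν s • ν[|s] = ν.restrict s := by
  by_cases hs : ν s = 0
  · rw [hs, zero_smul, Measure.restrict_eq_zero.2 hs]
  · rw [ProbabilityTheory.cond, smul_smul, ENNReal.mul_inv_cancel hs (measure_ne_top _ _), one_smul]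

namespace IsMVPS

variable {Ω E : Type*} {mΩ : MeasurableSpace Ω} {mE : MeasurableSpace E} [StandardBorelSpace E]
  {μ : Measure Ω} {θ : ℝ} {ν : Measure E} [IsFiniteMeasure ν] {R : E → Measure E} {X : ℕ → Ω → E}

theorem nonnullKernel_ae_eq_smul_condExpKernel (hX : IsMVPS μ θ ν R X) (hcan : IsCanonical R)
    (hexch : Exchangeable μ X) :
    ∀ᵐ x ∂ν.restrict (nullPart R)ᶜ,
      hX.nonnullKernel x = ν (nullPart R)ᶜ • condExpKernel ν (reinfSigma R) x := by
  have := hX.isFiniteKernel_nonnullKernel hcan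
  have hG : reinfSigma R ≤ mE := hX.measurable_reinf.comap_le
  have hZ := measurableSet_reinfSigma_compl_nullPart R
  refine ae_restrict_eq_smul_condExpKernel hG hZ (fun A hA => ?_) fun A B hA hB => ?_
  · simp only [hX.nonnullKernel_apply_apply _ hA]
    exact measurable_reinfSigma_apply R (hA.inter (hG _ hZ))
  · rw [hX.isReversible_nonnullKernel hcan hexch (hG _ hB) hA]
    have hBE := hG _ hB
    obtain ⟨S, -, rfl⟩ := hB
    rw [lintegral_congr_ae (ae_restrict_of_ae (hX.nonnullKernel_preimage_ae_eq hcan hexch S)),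
      setLIntegral_indicator hBE, setLIntegral_const]

theorem reinf_ae_eq (hX : IsMVPS μ θ ν R X) (hcan : IsCanonical R) (hexch : Exchangeable μ X) :
    ∀ᵐ x ∂ν.restrict (nullPart R)ᶜ,
      R x = ν (nullPart R)ᶜ • condExpKernel ν (reinfSigma R) x +
        ν (nullPart R) • ν[|nullPart R] := by
  filter_upwards [hX.nonnullKernel_ae_eq_smul_condExpKernel hcan hexch,
    hX.restrict_nullPart_ae_eq hcan hexch] with x hcompl hnull
  rw [smul_cond_eq_restrict, ← hcompl, ← hnull, hX.nonnullKernel_apply,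
    Measure.restrict_compl_add_restrict hX.measurableSet_nullPart]

theorem isConditioningSigma_reinfSigma (hX : IsMVPS μ θ ν R X) (hcan : IsCanonical R)
    (hexch : Exchangeable μ X) : IsConditioningSigma (reinfSigma R) ν R where
  le := hX.measurable_reinf.comap_le
  countablyGenerated := by
    have := hX.isProbabilityMeasure
    have := hX.finite_reinf
    have hgen := countablyGenerated_comap_measure R
    exact ⟨Set.univ, .univ, measure_univ,
      @MeasurableSpace.CountablyGenerated.comap _ _ (reinfSigma R) hgen _⟩
  measurableSet_compl := measurableSet_reinfSigma_compl_nullPart R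
  representation := by
    have hZ := hX.measurableSet_nullPart.compl
    rw [← ae_restrict_iff' hZ]
    filter_upwards [hX.reinf_ae_eq hcan hexch, ae_restrict_mem hZ] with x hx hxZ
    rw [hcan x hxZ, inv_one, one_smul, hx]

end IsMVPS

theorem IsConditioningSigma.isMVPS_atomMap {Ω E : Type*} {mΩ : MeasurableSpace Ω}
    {G mE : MeasurableSpace E} [StandardBorelSpace E] {μ : Measure Ω} {θ : ℝ} {ν : Measure E}
    [IsFiniteMeasure ν] {R : E → Measure E} {X : ℕ → Ω → E} (hG : IsConditioningSigma G ν R)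
    (hX : IsMVPS μ θ ν R X) (hexch : Exchangeable μ X) (hcan : IsCanonical R) :
    IsMVPS μ θ (atomLaw G ν) (atomReinforcement G ν (nullPart R))
      (fun n ω => atomMap G (X n ω)) :=
  have hZ : MeasurableSet[G] (nullPart R) := by simpa using hG.measurableSet_compl.compl
  hX.map (fun n => (hexch.map_eq n).trans hX.law_first) (measurable_atomMap hG.le)
    (measurable_atomReinforcement ν hZ) (isFiniteMeasure_atomReinforcement ν _)
    fun _ hP => hG.reinf_preimage_ae_eq hcan hP

theorem mainTheorem11_general {Ω 𝕏 : Type*} [MeasurableSpace Ω] [MeasurableSpace 𝕏]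
    [StandardBorelSpace 𝕏] (μ : Measure Ω) (θ : ℝ) (ν : Measure 𝕏) [IsFiniteMeasure ν]
    (R : 𝕏 → Measure 𝕏) (X : ℕ → Ω → 𝕏) (hX : IsMVPS μ θ ν R X) (hexch : Exchangeable μ X)
    (hcan : IsCanonical R) :
    (∃ G : MeasurableSpace 𝕏, IsConditioningSigma G ν R) ∧
    ∀ G : MeasurableSpace 𝕏, IsConditioningSigma G ν R →
      IsMVPS μ θ (atomLaw G ν) (atomReinforcement G ν (nullPart R))
        (fun n ω => atomMap G (X n ω)) ∧
      Exchangeable μ (fun n ω => atomMap G (X n ω)) :=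
  ⟨⟨_, hX.isConditioningSigma_reinfSigma hcan hexch⟩, fun _ hG =>
    ⟨hG.isMVPS_atomMap hX hexch hcan, hexch.comp (measurable_atomMap hG.le)⟩⟩

theorem mainTheorem11 {Ω 𝕏 : Type*} [MeasurableSpace Ω] [MeasurableSpace 𝕏]
    [StandardBorelSpace 𝕏] (μ : Measure Ω) [IsProbabilityMeasure μ]
    (θ : ℝ) (ν : Measure 𝕏) [IsProbabilityMeasure ν] (R : 𝕏 → Measure 𝕏) (X : ℕ → Ω → 𝕏)
    (hX : IsMVPS μ θ ν R X) (hexch : Exchangeable μ X) (hcan : IsCanonical R)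
    (hZ_pos : 0 < ν (nullPart R)) (hZ_lt : ν (nullPart R) < 1) :
    (∃ G : MeasurableSpace 𝕏, IsConditioningSigma G ν R) ∧
    ∀ G : MeasurableSpace 𝕏, IsConditioningSigma G ν R →
      IsMVPS μ θ (atomLaw G ν) (atomReinforcement G ν (nullPart R))
        (fun n ω => atomMap G (X n ω)) ∧
      Exchangeable μ (fun n ω => atomMap G (X n ω)) :=
  mainTheorem11_general μ θ ν R X hX hexch hcan
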